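/- Let $\mathcal X\subset\mathbb R^{d}$ (data space), $\mathcal Z\subset\mathbb R^{d_z}$ (latent space), $\Phi\subset\mathbb R^{d_\phi}$ and $\Theta\subset\mathbb R^{d_\theta}$ (encoder and decoder parameters), with Euclidean norms, and let $\Delta>0$ satisfy $\sup_{x,x'\in\mathcal X}\|x-x'\|<\Delta^{1/2}$. Let $\mathcal D$ be a probability distribution on $\mathcal X$, let $n\ge 1$, and let $S=(S_1,\dots,S_n)$ be i.i.d. with law $\mathcal D$. A randomized learning algorithm (a Markov kernel) draws parameters $(\mathbf e,\phi,\theta)\sim q(\mathbf e,\phi,\theta\mid S)$, where $\mathbf e=(e_1,\dots,e_K)\in\mathcal Z^K$ is a codebook, $\phi\in\Phi$ and $\theta\in\Theta$. Let $q(J\mid\mathbf e,\phi,x)$ be the posterior on the latent index $J\in\{1,\dots,K\}$ of a data point $x$ (a Markov kernel; in particular, a softmax or a nearest-codeword encoder), let $g_\theta:\mathcal Z\to\mathcal X$ be decoders that are measurable for every $\theta\in\Theta$, and let $l(x,x')=\|x-x'\|^2$. Let $\pi(J\mid\mathbf e,\phi)$ be any data-independent prior, that is, any Markov kernel from $\mathcal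 Z^K\times\Phi$ to $\{1,\dots,K\}$, and let $\hat\mu=g_\theta\#\pi(e\mid\mathbf e,\phi)$ be the generated distribution on $\mathcal X$: the law of $g_\theta(e_J)$ for $J\sim\pi(\cdot\mid\mathbf e,\phi)$. Then $$\mathbb E_S\,\mathbb E_{q(\mathbf e,\phi,\theta\mid S)}W_2^2(\mathcal D,\hat\mu)\le\frac{2\Delta}{\sqrt n}+\mathbb E_S\,\mathbb E_{q(\mathbf e,\phi,\theta\mid S)}\Bigg[\frac2n\sum_{m=1}^n\mathbb E_{q(J_m\mid\mathbf e,\phi,S_m)}\,l\big(S_m,g_\theta(e_{J_m})\big)+4\Delta\sqrt{\frac2n\sum_{m=1}^n\mathrm{KL}\big(q(J_m\mid\mathbf e,\phi,S_m)\,\big\|\,\pi(J\mid\mathbf e,\phi)\big)}\Bigg],$$ where $W_2(\mu,\nu)=\big(\inf_\rho\int\|x-x'\|^2\,d\rho(x,x')\big)^{1/2}$, with the infimum over all couplings $\rho$ of $\mu$ and $\nu$, and the right-hand side may be $+\infty$. -/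

import Mathlib

open MeasureTheory ProbabilityTheory
open scoped ENNReal

namespace VQVAE

/-- The couplings of `μ` and `ν`: measures on the product with marginals `μ` and `ν`. -/
def couplings {E : Type*} [MeasurableSpace E] (μ ν : Measure E) : Set (Measure (E × E)) :=
  {ρ | ρ.map Prod.fst = μ ∧ ρ.map Prod.snd = ν}

/-- The 2-Wasserstein distance
`W₂(μ, ν) = (inf over couplings ρ of ∫ d(x, x')² dρ(x, x')) ^ (1/2)`. -/
noncomputable def W2 {E : Type*} [PseudoEMetricSpace E] [MeasurableSpace E]
    (μ ν : Measure E) : ℝ≥0∞ :=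
  (⨅ ρ ∈ couplings μ ν, ∫⁻ p, edist p.1 p.2 ^ 2 ∂ρ) ^ (1 / 2 : ℝ)

variable {d dz dφ dθ : ℕ}

/-- The squared Euclidean reconstruction loss `l(x, y) = ‖x - y‖²`. -/
noncomputable def loss {𝒳 : Set (EuclideanSpace ℝ (Fin d))} (x y : 𝒳) : ℝ :=
  ‖(x : EuclideanSpace ℝ (Fin d)) - (y : EuclideanSpace ℝ (Fin d))‖ ^ 2

/-- The parameters `w = (e, φ, θ)`: a codebook `e` of `K` points of the latent space `𝒵`, an
encoder parameter `φ` and a decoder parameter `θ`. -/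
abbrev Params (K : ℕ) (𝒵 : Set (EuclideanSpace ℝ (Fin dz))) (Φ : Set (EuclideanSpace ℝ (Fin dφ)))
    (Θ : Set (EuclideanSpace ℝ (Fin dθ))) : Type :=
  (Fin K → 𝒵) × Φ × Θ

/-- The expected reconstruction loss `l₀(w, x) = E_{q(J | e, φ, x)} l(x, g_θ(e_J))` of the
parameters `w = (e, φ, θ)` at the data point `x`, for the posterior `q` on the latent index. -/
noncomputable def expectedLoss {K : ℕ} {𝒳 : Set (EuclideanSpace ℝ (Fin d))}
    {𝒵 : Set (EuclideanSpace ℝ (Fin dz))} {Φ : Set (EuclideanSpace ℝ (Fin dφ))}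
    {Θ : Set (EuclideanSpace ℝ (Fin dθ))} (g : Θ → 𝒵 → 𝒳)
    (q : Kernel (((Fin K → 𝒵) × Φ) × 𝒳) (Fin K)) (w : Params K 𝒵 Φ Θ) (x : 𝒳) : ℝ≥0∞ :=
  ∫⁻ j, ENNReal.ofReal (loss x (g w.2.2 (w.1 j))) ∂(q ((w.1, w.2.1), x))

/-- The generated distribution `μ̂ = g_θ # π(e | e, φ)`: the prior `π(J | e, φ)` on the latent index,
carried to the latent space by `j ↦ e_j`, and pushed forward by the decoder `g_θ`. -/
noncomputable def generated {K : ℕ} {𝒳 : Set (EuclideanSpace ℝ (Fin d))}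
    {𝒵 : Set (EuclideanSpace ℝ (Fin dz))} {Φ : Set (EuclideanSpace ℝ (Fin dφ))}
    {Θ : Set (EuclideanSpace ℝ (Fin dθ))} (g : Θ → 𝒵 → 𝒳)
    (π : Kernel ((Fin K → 𝒵) × Φ) (Fin K)) (w : Params K 𝒵 Φ Θ) : Measure 𝒳 :=
  ((π (w.1, w.2.1)).map w.1).map (g w.2.2)

end VQVAE

namespace VQVAE

/-! ### Change of measure: integrals against the prior controlled by the posterior and KL. -/

section ChangeOfMeasure

/-! The independent coupling bounds `W2 ^ 2` by the population mean of the loss against decoded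
prior indices. Expand that loss about the mean `a` of the data: it is `‖x - a‖ ^ 2`, plus a term
linear in `x - a`, plus a term free of `x`. So the gap between population and empirical means is a
variance fluctuation independent of the parameters plus an inner product with the centred empirical
mean, at most `2 * √Δ` times its norm by Cauchy–Schwarz (`integral_add_le_of_norm_sub_le`). This is
uniform in the parameters, so their dependence on the sample costs nothing. The fluctuation has
expectation zero, and the norm has mean at most `√Δ / √n` (`lintegral_norm_empirical_mean_le`),
whence `2 * Δ / √n`. The empirical loss still averages over the prior; a Hellinger-type Pinsker
bound (`lintegral_le_add_mul_sqrt_klDiv`) passes to the posterior at each data point. -/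

lemma sq_one_sub_sqrt_le_klFun {t : ℝ} (ht : 0 ≤ t) :
    (1 - √t) ^ 2 ≤ InformationTheory.klFun t := by
  rcases ht.eq_or_lt with rfl | ht
  · simp [InformationTheory.klFun_apply]
  have hs : 0 < √t := Real.sqrt_pos.2 ht
  have hsq : √t * √t = t := Real.mul_self_sqrt ht.le
  have hlog : Real.log t = 2 * Real.log √t := by
    rw [Real.log_sqrt ht.le]; ring
  -- Used at `√t` rather than `t`, so that the lower bound for `klFun t` is a perfect square.
  have h := Real.one_sub_inv_le_log_of_pos hs
  have h2 : t * (1 - (√t)⁻¹) ≤ t * Real.log √t := mul_le_mul_of_nonneg_left h ht.le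
  have h3 : t * (√t)⁻¹ = √t := by
    field_simp
    rw [sq, hsq]
  rw [InformationTheory.klFun_apply, hlog]
  nlinarith

/-- Since `1 - t = 2 * (1 - √t) - (1 - √t) ^ 2`, the Hellinger bound applies. With `t` a density,
this is the pointwise form of Pinsker. -/
lemma one_le_add_two_mul_sqrt_klFun {t : ℝ} (ht : 0 ≤ t) :
    1 ≤ t + 2 * √(InformationTheory.klFun t) := by
  have h : 1 - √t ≤ √(InformationTheory.klFun t) :=
    Real.le_sqrt_of_sq_le (sq_one_sub_sqrt_le_klFun ht)
  nlinarith [Real.mul_self_sqrt ht, sq_nonneg (1 - √t)]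

lemma rpow_half_rpow_two (x : ℝ≥0∞) : (x ^ (1 / 2 : ℝ)) ^ (2 : ℝ) = x := by
  rw [← ENNReal.rpow_mul]
  norm_num

lemma lintegral_sqrt_le {α : Type*} [MeasurableSpace α] (ν : Measure α) [IsProbabilityMeasure ν]
    {f : α → ℝ≥0∞} (hf : AEMeasurable f ν) :
    ∫⁻ x, f x ^ (1 / 2 : ℝ) ∂ν ≤ (∫⁻ x, f x ∂ν) ^ (1 / 2 : ℝ) := by
  have h := ENNReal.lintegral_mul_le_Lp_mul_Lq ν Real.HolderConjugate.two_two
    (f := fun x => f x ^ (1 / 2 : ℝ)) (g := fun _ => 1) (hf.pow_const _)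
    aemeasurable_const
  simpa only [Pi.mul_apply, mul_one, rpow_half_rpow_two, ENNReal.one_rpow,
    lintegral_const, measure_univ] using h

/-- A weak form of Pinsker's inequality, for the integrals of a bounded function. -/
lemma lintegral_le_add_mul_sqrt_klDiv {α : Type*} [MeasurableSpace α] (μ ν : Measure α)
    [IsProbabilityMeasure μ] [IsProbabilityMeasure ν] {f : α → ℝ≥0∞} (hf : Measurable f)
    {C : ℝ≥0∞} (hC0 : C ≠ 0) (hfC : ∀ x, f x ≤ C) :
    ∫⁻ x, f x ∂ν ≤
      ∫⁻ x, f x ∂μ + 2 * C * InformationTheory.klDiv μ ν ^ (1 / 2 : ℝ) := by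
  by_cases hac : μ ≪ ν
  swap
  -- The divergence is infinite; `C ≠ 0` keeps the product infinite, as `0 * ∞ = 0`.
  · simp [InformationTheory.klDiv_of_not_ac hac, hC0]
  rw [InformationTheory.klDiv_eq_lintegral_klFun_of_ac hac]
  set k : α → ℝ≥0∞ := fun x =>
    ENNReal.ofReal (InformationTheory.klFun (μ.rnDeriv ν x).toReal) with hk
  have hkm : Measurable k := by
    rw [hk]; fun_prop
  have hpt : ∀ᵐ x ∂ν, f x ≤ μ.rnDeriv ν x * f x + 2 * C * k x ^ (1 / 2 : ℝ) := by
    filter_upwards [μ.rnDeriv_lt_top ν] with x hx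
    have h1 := one_le_add_two_mul_sqrt_klFun (ENNReal.toReal_nonneg (a := μ.rnDeriv ν x))
    have h2 : (1 : ℝ≥0∞) ≤ μ.rnDeriv ν x + 2 * k x ^ (1 / 2 : ℝ) := by
      have h3 := ENNReal.ofReal_le_ofReal h1
      rw [ENNReal.ofReal_add ENNReal.toReal_nonneg (by positivity),
        ENNReal.ofReal_toReal hx.ne, ENNReal.ofReal_mul (by norm_num), Real.sqrt_eq_rpow,
        ← ENNReal.ofReal_rpow_of_nonneg
          (InformationTheory.klFun_nonneg ENNReal.toReal_nonneg) (by norm_num)] at h3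
      simpa using h3
    calc f x = 1 * f x := (one_mul _).symm
      _ ≤ (μ.rnDeriv ν x + 2 * k x ^ (1 / 2 : ℝ)) * f x := by gcongr
      _ = μ.rnDeriv ν x * f x + 2 * f x * k x ^ (1 / 2 : ℝ) := by ring
      _ ≤ _ := by gcongr; exact hfC x
  calc ∫⁻ x, f x ∂ν ≤ ∫⁻ x, (μ.rnDeriv ν x * f x + 2 * C * k x ^ (1 / 2 : ℝ)) ∂ν :=
        lintegral_mono_ae hpt
    _ = ∫⁻ x, f x ∂μ + 2 * C * ∫⁻ x, k x ^ (1 / 2 : ℝ) ∂ν := by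
        rw [lintegral_add_left (by fun_prop), lintegral_rnDeriv_mul hac hf.aemeasurable,
          lintegral_const_mul _ (hkm.pow_const _)]
    _ ≤ _ := by gcongr; exact lintegral_sqrt_le ν hkm.aemeasurable

lemma arith_mean_sqrt_le {n : ℕ} (hn : 0 < n) (z : Fin n → ℝ≥0∞) :
    (n : ℝ≥0∞)⁻¹ * ∑ m, z m ^ (1 / 2 : ℝ) ≤ ((n : ℝ≥0∞)⁻¹ * ∑ m, z m) ^ (1 / 2 : ℝ) := by
  have hw : ∑ _m : Fin n, (n : ℝ≥0∞)⁻¹ = 1 := by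
    simp [ENNReal.mul_inv_cancel (Nat.cast_ne_zero.2 hn.ne') (ENNReal.natCast_ne_top n)]
  have h := ENNReal.rpow_arith_mean_le_arith_mean_rpow Finset.univ (fun _ => (n : ℝ≥0∞)⁻¹)
    (fun m => z m ^ (1 / 2 : ℝ)) hw (p := 2) (by norm_num)
  simp only [rpow_half_rpow_two] at h
  rw [← ENNReal.rpow_le_rpow_iff (z := 2) (by norm_num), rpow_half_rpow_two,
    Finset.mul_sum, Finset.mul_sum]
  exact h

end ChangeOfMeasure

/-! ### Wasserstein distance and the independent coupling. -/

section Transport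

lemma W2_sq_le_lintegral_lintegral {E : Type*} [PseudoEMetricSpace E] [MeasurableSpace E]
    [OpensMeasurableSpace (E × E)] (μ ν : Measure E) [IsProbabilityMeasure μ]
    [IsProbabilityMeasure ν] :
    W2 μ ν ^ 2 ≤ ∫⁻ x, ∫⁻ y, edist x y ^ 2 ∂ν ∂μ := by
  have hm : Measurable fun p : E × E => edist p.1 p.2 ^ 2 :=
    (continuous_edist.measurable).pow_const 2
  rw [W2, ← ENNReal.rpow_natCast, ← ENNReal.rpow_mul]
  norm_num
  refine (iInf₂_le (μ.prod ν) ?_).trans_eq (lintegral_prod _ hm.aemeasurable)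
  simp [couplings, Measure.map_fst_prod, Measure.map_snd_prod]

end Transport

/-! ### Empirical versus population means of squared distances. -/

section Sampling

variable {d K : ℕ}

lemma integral_sq_norm_sub_eq (ν : Measure (Fin K)) [IsProbabilityMeasure ν]
    (y : Fin K → EuclideanSpace ℝ (Fin d)) (a x : EuclideanSpace ℝ (Fin d)) :
    ∫ j, ‖x - y j‖ ^ 2 ∂ν =
      ‖x - a‖ ^ 2 - 2 * inner ℝ (x - a) (∫ j, (y j - a) ∂ν) + ∫ j, ‖y j - a‖ ^ 2 ∂ν := by
  have h : ∀ j, ‖x - y j‖ ^ 2 =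
      ‖x - a‖ ^ 2 - 2 * inner ℝ (x - a) (y j - a) + ‖y j - a‖ ^ 2 := fun j => by
    rw [← norm_sub_sq_real]; congr 2; abel
  simp_rw [h]
  rw [integral_add .of_finite .of_finite, integral_sub .of_finite .of_finite,
    integral_const_mul, integral_inner .of_finite]
  simp

/-- The population mean of a mixture of squared distances exceeds its empirical mean by at most a
term in which the mixture does not appear. -/
lemma integral_add_le_of_norm_sub_le {α : Type*} [MeasurableSpace α] (μ : Measure α)
    [IsProbabilityMeasure μ] {X : α → EuclideanSpace ℝ (Fin d)} (hX : MemLp X 2 μ)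
    {n : ℕ} (hn : 0 < n) (S : Fin n → α) (ν : Measure (Fin K)) [IsProbabilityMeasure ν]
    (y : Fin K → EuclideanSpace ℝ (Fin d)) {a : EuclideanSpace ℝ (Fin d)} (ha : a = ∫ x, X x ∂μ)
    {R : ℝ} (hy : ∀ j, ‖y j - a‖ ≤ R) :
    (∫ x, ∫ j, ‖X x - y j‖ ^ 2 ∂ν ∂μ) + (n : ℝ)⁻¹ * ∑ m, ‖X (S m) - a‖ ^ 2 ≤
      (∫ x, ‖X x - a‖ ^ 2 ∂μ) + (n : ℝ)⁻¹ * (∑ m, ∫ j, ‖X (S m) - y j‖ ^ 2 ∂ν) +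
        2 * R * ‖(n : ℝ)⁻¹ • ∑ m, (X (S m) - a)‖ := by
  simp_rw [integral_sq_norm_sub_eq ν y a]
  set b := ∫ j, (y j - a) ∂ν
  set c := ∫ j, ‖y j - a‖ ^ 2 ∂ν
  have hXa : MemLp (fun x => X x - a) 2 μ := hX.sub (memLp_const a)
  have hi : Integrable (fun x => X x - a) μ := hXa.integrable (by norm_num)
  have h0 : ∫ x, (X x - a) ∂μ = 0 := by
    rw [integral_sub (hX.integrable (by norm_num)) (integrable_const a)]
    simp [ha]
  have hin : Integrable (fun x => inner ℝ (X x - a) b) μ := hi.inner_const b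
  have hsq : Integrable (fun x => ‖X x - a‖ ^ 2) μ := hXa.integrable_norm_pow (by norm_num)
  -- Centring at the mean kills the cross term for the population; the empirical one keeps `inner ℝ
  -- v b`.
  have h1 : ∫ x, (inner ℝ (X x - a) b : ℝ) ∂μ = 0 := by
    simp_rw [real_inner_comm b]
    rw [integral_inner hi, h0, inner_zero_right]
  have h2 : ∫ x, (‖X x - a‖ ^ 2 - 2 * inner ℝ (X x - a) b + c) ∂μ =
      (∫ x, ‖X x - a‖ ^ 2 ∂μ) + c := by
    rw [integral_add (f := fun x => ‖X x - a‖ ^ 2 - 2 * inner ℝ (X x - a) b)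
      (hsq.sub (hin.const_mul 2)) (integrable_const c), integral_sub hsq (hin.const_mul 2), integral_const_mul, h1]
    simp
  have hb : ‖b‖ ≤ R := by
    simpa using norm_integral_le_of_norm_le_const (μ := ν) (.of_forall hy)
  set v := (n : ℝ)⁻¹ • ∑ m, (X (S m) - a) with hv
  have hvb : (inner ℝ v b : ℝ) ≤ ‖v‖ * R :=
    (real_inner_le_norm v b).trans (mul_le_mul_of_nonneg_left hb (norm_nonneg v))
  have h3 : (n : ℝ)⁻¹ * ∑ m, (‖X (S m) - a‖ ^ 2 - 2 * inner ℝ (X (S m) - a) b + c) =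
      (n : ℝ)⁻¹ * ∑ m, ‖X (S m) - a‖ ^ 2 - 2 * inner ℝ v b + c := by
    have hn' : (n : ℝ) ≠ 0 := Nat.cast_ne_zero.2 hn.ne'
    rw [Finset.sum_add_distrib, Finset.sum_sub_distrib, ← Finset.mul_sum, hv,
      real_inner_smul_left, sum_inner]
    simp only [Finset.sum_const, Finset.card_univ, Fintype.card_fin, nsmul_eq_mul]
    field_simp
  rw [h2, h3]
  linarith

/-- Variances of independent sums add in each coordinate. -/
lemma integral_sq_norm_sum_eq {α : Type*} [MeasurableSpace α] (μ : Measure α)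
    [IsProbabilityMeasure μ] {Y : α → EuclideanSpace ℝ (Fin d)} (hY : MemLp Y 2 μ)
    (hY0 : ∫ x, Y x ∂μ = 0) (n : ℕ) :
    ∫ S, ‖∑ m, Y (S m)‖ ^ 2 ∂(Measure.pi fun _ : Fin n => μ) = n * ∫ x, ‖Y x‖ ^ 2 ∂μ := by
  have hYi : ∀ i, MemLp (fun x => Y x i) 2 μ := fun i =>
    hY.continuousLinearMap_comp (EuclideanSpace.proj (𝕜 := ℝ) i)
  have hYi0 : ∀ i, ∫ x, Y x i ∂μ = 0 := fun i => by
    have h := (EuclideanSpace.proj (𝕜 := ℝ) i).integral_comp_comm (hY.integrable (by norm_num))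
    rw [hY0] at h
    simpa using h
  have hYS : ∀ i (m : Fin n), MemLp (fun S : Fin n → α => Y (S m) i) 2
      (Measure.pi fun _ : Fin n => μ) := fun i m =>
    (hYi i).comp_measurePreserving (measurePreserving_eval (fun _ : Fin n => μ) m)
  have hsum : ∀ i, MemLp (fun S : Fin n → α => ∑ m, Y (S m) i) 2
      (Measure.pi fun _ : Fin n => μ) := fun i => memLp_finsetSum _ fun m _ => hYS i m
  have hvar : ∀ i, ∫ S, (∑ m, Y (S m) i) ^ 2 ∂(Measure.pi fun _ : Fin n => μ) =
      n * ∫ x, Y x i ^ 2 ∂μ := fun i => by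
    have h := variance_sum_pi (μ := fun _ : Fin n => μ) (X := fun _ x => Y x i) fun _ => hYi i
    rw [variance_of_integral_eq_zero, variance_of_integral_eq_zero (hYi i).aemeasurable (hYi0 i)]
      at h
    · simpa using h
    · convert (hsum i).aemeasurable using 1
      ext S
      simp
    · simp only [Finset.sum_apply]
      rw [integral_finsetSum _ fun m _ => (hYS i m).integrable (by norm_num)]
      refine Finset.sum_eq_zero fun m _ => ?_
      rw [integral_comp_eval (μ := fun _ : Fin n => μ) (f := fun x => Y x i)
        (hYi i).aestronglyMeasurable, hYi0]
  simp_rw [EuclideanSpace.norm_sq_eq, WithLp.ofLp_sum, Finset.sum_apply, Real.norm_eq_abs, sq_abs]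
  rw [integral_finsetSum _ fun i _ => (hsum i).integrable_sq,
    integral_finsetSum _ fun i _ => (hYi i).integrable_sq, Finset.mul_sum]
  exact Finset.sum_congr rfl fun i _ => hvar i

/-- The mean norm of the empirical mean of a bounded centred random vector. -/
lemma lintegral_norm_empirical_mean_le {α : Type*} [MeasurableSpace α] (μ : Measure α)
    [IsProbabilityMeasure μ] {Y : α → EuclideanSpace ℝ (Fin d)} (hY : MemLp Y 2 μ)
    (hY0 : ∫ x, Y x ∂μ = 0) {n : ℕ} (hn : 0 < n) {R : ℝ} (hR0 : 0 ≤ R)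
    (hR : ∀ x, ‖Y x‖ ≤ R) :
    ∫⁻ S, ENNReal.ofReal ‖(n : ℝ)⁻¹ • ∑ m, Y (S m)‖ ∂(Measure.pi fun _ : Fin n => μ) ≤
      ENNReal.ofReal (R / √n) := by
  have hn' : (0 : ℝ) < n := Nat.cast_pos.2 hn
  have hv' : MemLp (fun S : Fin n → α => ∑ m, Y (S m)) 2 (Measure.pi fun _ : Fin n => μ) :=
    memLp_finsetSum _ fun m _ =>
      hY.comp_measurePreserving (measurePreserving_eval (fun _ : Fin n => μ) m)
  have hv : MemLp (fun S : Fin n → α => (n : ℝ)⁻¹ • ∑ m, Y (S m)) 2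
      (Measure.pi fun _ : Fin n => μ) := hv'.const_smul (n : ℝ)⁻¹
  have hsq : ∫ S, ‖(n : ℝ)⁻¹ • ∑ m, Y (S m)‖ ^ 2 ∂(Measure.pi fun _ : Fin n => μ) ≤
      R ^ 2 / n := by
    have hle : ∫ x, ‖Y x‖ ^ 2 ∂μ ≤ R ^ 2 := by
      simpa using integral_mono (hY.integrable_norm_pow (by norm_num)) (integrable_const (R ^ 2))
        fun x => pow_le_pow_left₀ (norm_nonneg _) (hR x) 2
    simp_rw [norm_smul, mul_pow]
    rw [integral_const_mul, integral_sq_norm_sum_eq μ hY hY0, norm_inv, Real.norm_natCast]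
    calc (n : ℝ)⁻¹ ^ 2 * (n * ∫ x, ‖Y x‖ ^ 2 ∂μ) ≤ (n : ℝ)⁻¹ ^ 2 * (n * R ^ 2) := by gcongr
      _ = R ^ 2 / n := by field_simp
  have hrw : ∀ r : ℝ, 0 ≤ r → ENNReal.ofReal r = ENNReal.ofReal (r ^ 2) ^ (1 / 2 : ℝ) :=
    fun r hr => by
      rw [ENNReal.ofReal_rpow_of_nonneg (sq_nonneg r) (by norm_num), ← Real.sqrt_eq_rpow,
        Real.sqrt_sq hr]
  calc ∫⁻ S, ENNReal.ofReal ‖(n : ℝ)⁻¹ • ∑ m, Y (S m)‖ ∂(Measure.pi fun _ : Fin n => μ)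
      = ∫⁻ S, ENNReal.ofReal (‖(n : ℝ)⁻¹ • ∑ m, Y (S m)‖ ^ 2) ^ (1 / 2 : ℝ)
          ∂(Measure.pi fun _ : Fin n => μ) := lintegral_congr fun S => hrw _ (norm_nonneg _)
    _ ≤ (∫⁻ S, ENNReal.ofReal (‖(n : ℝ)⁻¹ • ∑ m, Y (S m)‖ ^ 2)
          ∂(Measure.pi fun _ : Fin n => μ)) ^ (1 / 2 : ℝ) :=
        lintegral_sqrt_le _ (hv.aestronglyMeasurable.norm.aemeasurable.pow_const 2).ennreal_ofReal
    _ ≤ ENNReal.ofReal (R ^ 2 / n) ^ (1 / 2 : ℝ) := by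
        rw [← ofReal_integral_eq_lintegral_ofReal (hv.integrable_norm_pow (by norm_num))
          (.of_forall fun S => sq_nonneg _)]
        gcongr
    _ = ENNReal.ofReal (R / √n) := by
        rw [hrw (R / √n) (by positivity), div_pow, Real.sq_sqrt hn'.le]

end Sampling

/-! ### The bounds for fixed sample and parameters. -/

section Bound

variable {d dz dφ dθ K n : ℕ} {𝒳 : Set (EuclideanSpace ℝ (Fin d))}
  {𝒵 : Set (EuclideanSpace ℝ (Fin dz))} {Φ : Set (EuclideanSpace ℝ (Fin dφ))}
  {Θ : Set (EuclideanSpace ℝ (Fin dθ))}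

lemma norm_sub_le_of_ediam_lt {R : ℝ} (hbdd : Metric.ediam 𝒳 < ENNReal.ofReal R) (x y : 𝒳) :
    ‖(x : EuclideanSpace ℝ (Fin d)) - y‖ ≤ R := by
  have h := (Metric.edist_le_ediam_of_mem x.2 y.2).trans_lt hbdd
  rw [edist_dist, dist_eq_norm] at h
  exact (ENNReal.ofReal_lt_ofReal_iff_of_nonneg (norm_nonneg _)).1 h |>.le

lemma edist_sq_eq_ofReal_loss (x y : 𝒳) : edist x y ^ 2 = ENNReal.ofReal (loss x y) := by
  rw [edist_dist, ← ENNReal.ofReal_pow dist_nonneg, Subtype.dist_eq, dist_eq_norm, loss]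

lemma memLp_subtype_val (𝒟 : Measure 𝒳) [IsProbabilityMeasure 𝒟] {R : ℝ}
    (hR : ∀ x y : 𝒳, ‖(x : EuclideanSpace ℝ (Fin d)) - y‖ ≤ R) :
    MemLp (fun x : 𝒳 => (x : EuclideanSpace ℝ (Fin d))) 2 𝒟 := by
  obtain ⟨x₀⟩ : Nonempty 𝒳 := 𝒟.nonempty_of_neZero
  refine MemLp.of_bound measurable_subtype_coe.aestronglyMeasurable
    (R + ‖(x₀ : EuclideanSpace ℝ (Fin d))‖) (.of_forall fun x => ?_)
  have h := norm_add_le ((x : EuclideanSpace ℝ (Fin d)) - x₀) x₀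
  rw [sub_add_cancel] at h
  exact h.trans (by gcongr; exact hR x x₀)

lemma norm_sub_integral_le (𝒟 : Measure 𝒳) [IsProbabilityMeasure 𝒟] {R : ℝ}
    (hR : ∀ x y : 𝒳, ‖(x : EuclideanSpace ℝ (Fin d)) - y‖ ≤ R) (x : 𝒳) :
    ‖(x : EuclideanSpace ℝ (Fin d)) - ∫ y : 𝒳, (y : EuclideanSpace ℝ (Fin d)) ∂𝒟‖ ≤ R := by
  have hi := (memLp_subtype_val 𝒟 hR).integrable (by norm_num)
  have h : (x : EuclideanSpace ℝ (Fin d)) - ∫ y : 𝒳, (y : EuclideanSpace ℝ (Fin d)) ∂𝒟 =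
      ∫ y : 𝒳, ((x : EuclideanSpace ℝ (Fin d)) - y) ∂𝒟 := by
    rw [integral_sub (integrable_const _) hi]
    simp
  rw [h]
  simpa using norm_integral_le_of_norm_le_const (μ := 𝒟) (.of_forall fun y => hR x y)

/-- The squared distance to the generated distribution is at most the cost of the independent
coupling. -/
lemma W2_generated_sq_le (𝒟 : Measure 𝒳) [IsProbabilityMeasure 𝒟] (g : Θ → 𝒵 → 𝒳)
    (hg : ∀ θ, Measurable (g θ)) (π : Kernel ((Fin K → 𝒵) × Φ) (Fin K)) [IsMarkovKernel π]
    (w : Params K 𝒵 Φ Θ) :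
    W2 𝒟 (generated g π w) ^ 2 ≤
      ∫⁻ x, ∫⁻ j, ENNReal.ofReal (loss x (g w.2.2 (w.1 j))) ∂(π (w.1, w.2.1)) ∂𝒟 := by
  have hw : Measurable w.1 := measurable_of_finite _
  have hmap : generated g π w = (π (w.1, w.2.1)).map fun j => g w.2.2 (w.1 j) :=
    Measure.map_map (hg w.2.2) hw
  have hm : Measurable fun j => g w.2.2 (w.1 j) := (hg w.2.2).comp hw
  have : IsProbabilityMeasure (generated g π w) := by
    rw [hmap]
    exact Measure.isProbabilityMeasure_map hm.aemeasurable
  refine (W2_sq_le_lintegral_lintegral 𝒟 (generated g π w)).trans_eq ?_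
  refine lintegral_congr fun x => ?_
  have hx : Measurable fun y : 𝒳 => edist x y ^ 2 :=
    (Continuous.edist continuous_const continuous_id).measurable.pow_const 2
  rw [hmap, lintegral_map hx hm]
  simp_rw [edist_sq_eq_ofReal_loss]

lemma ofReal_integral_norm_sub_sq_eq (ν : Measure (Fin K)) [IsProbabilityMeasure ν] (x : 𝒳)
    (y : Fin K → 𝒳) :
    ENNReal.ofReal (∫ j, ‖(x : EuclideanSpace ℝ (Fin d)) - y j‖ ^ 2 ∂ν) =
      ∫⁻ j, ENNReal.ofReal (loss x (y j)) ∂ν :=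
  ofReal_integral_eq_lintegral_ofReal .of_finite (.of_forall fun _ => sq_nonneg _)

/-- The two variance terms sit on opposite sides to avoid truncated subtraction in `ℝ≥0∞`. -/
lemma lintegral_lintegral_loss_add_le (𝒟 : Measure 𝒳) [IsProbabilityMeasure 𝒟] {R : ℝ}
    (hR : ∀ x y : 𝒳, ‖(x : EuclideanSpace ℝ (Fin d)) - y‖ ≤ R) (hn : 0 < n) (S : Fin n → 𝒳)
    (ν : Measure (Fin K)) [IsProbabilityMeasure ν] (y : Fin K → 𝒳)
    {a : EuclideanSpace ℝ (Fin d)} (ha : a = ∫ x : 𝒳, (x : EuclideanSpace ℝ (Fin d)) ∂𝒟) :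
    (∫⁻ x, ∫⁻ j, ENNReal.ofReal (loss x (y j)) ∂ν ∂𝒟) +
        ENNReal.ofReal ((n : ℝ)⁻¹ * ∑ m, ‖(S m : EuclideanSpace ℝ (Fin d)) - a‖ ^ 2) ≤
      ENNReal.ofReal (∫ x : 𝒳, ‖(x : EuclideanSpace ℝ (Fin d)) - a‖ ^ 2 ∂𝒟) +
        (n : ℝ≥0∞)⁻¹ * (∑ m, ∫⁻ j, ENNReal.ofReal (loss (S m) (y j)) ∂ν) +
        ENNReal.ofReal (2 * R *
          ‖(n : ℝ)⁻¹ • ∑ m, ((S m : EuclideanSpace ℝ (Fin d)) - a)‖) := by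
  have hX := memLp_subtype_val 𝒟 hR
  have hR0 : 0 ≤ R := (norm_nonneg _).trans (hR (S ⟨0, hn⟩) (S ⟨0, hn⟩))
  have hbound : ∀ x : 𝒳, ∫ j, ‖(x : EuclideanSpace ℝ (Fin d)) - y j‖ ^ 2 ∂ν ≤ R ^ 2 :=
    fun x => by
      simpa using integral_mono (μ := ν) Integrable.of_finite (integrable_const (R ^ 2))
        fun j => pow_le_pow_left₀ (norm_nonneg _) (hR x (y j)) 2
  have hnonneg : ∀ x : 𝒳, 0 ≤ ∫ j, ‖(x : EuclideanSpace ℝ (Fin d)) - y j‖ ^ 2 ∂ν := fun x =>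
    integral_nonneg fun _ => sq_nonneg _
  have hmeas : Measurable fun x : 𝒳 =>
      ∫ j, ‖(x : EuclideanSpace ℝ (Fin d)) - y j‖ ^ 2 ∂ν := by
    simp_rw [integral_fintype (μ := ν) Integrable.of_finite]
    fun_prop
  have hint : Integrable (fun x : 𝒳 =>
      ∫ j, ‖(x : EuclideanSpace ℝ (Fin d)) - y j‖ ^ 2 ∂ν) 𝒟 :=
    .of_bound hmeas.aestronglyMeasurable (R ^ 2) (.of_forall fun x => by
      rw [Real.norm_of_nonneg (hnonneg x)]
      exact hbound x)
  have h := ENNReal.ofReal_le_ofReal (integral_add_le_of_norm_sub_le 𝒟 hX hn S ν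
    (fun j => (y j : EuclideanSpace ℝ (Fin d))) ha
    fun j => ha ▸ norm_sub_integral_le 𝒟 hR (y j))
  rw [ENNReal.ofReal_add (integral_nonneg hnonneg) (by positivity),
    ENNReal.ofReal_add (add_nonneg (integral_nonneg fun _ => sq_nonneg _)
      (mul_nonneg (by positivity) (Finset.sum_nonneg fun m _ => hnonneg _))) (by positivity),
    ENNReal.ofReal_add (integral_nonneg fun _ => sq_nonneg _)
      (mul_nonneg (by positivity) (Finset.sum_nonneg fun m _ => hnonneg _)),
    ofReal_integral_eq_lintegral_ofReal hint (.of_forall hnonneg),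
    ENNReal.ofReal_mul (q := ∑ m, ∫ j, ‖(S m : EuclideanSpace ℝ (Fin d)) - y j‖ ^ 2 ∂ν)
      (by positivity), ENNReal.ofReal_sum_of_nonneg fun m _ => hnonneg _,
    ENNReal.ofReal_inv_of_pos (Nat.cast_pos.2 hn), ENNReal.ofReal_natCast] at h
  simpa only [ofReal_integral_norm_sub_sq_eq] using h

/-- Replacing the posterior by the prior in the empirical reconstruction loss. -/
lemma mean_lintegral_loss_le (g : Θ → 𝒵 → 𝒳) (q : Kernel (((Fin K → 𝒵) × Φ) × 𝒳) (Fin K))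
    [IsMarkovKernel q] (π : Kernel ((Fin K → 𝒵) × Φ) (Fin K)) [IsMarkovKernel π]
    {Δ : ℝ} (hΔ : 0 < Δ) (hloss : ∀ x y : 𝒳, loss x y ≤ Δ) (hn : 0 < n) (S : Fin n → 𝒳)
    (w : Params K 𝒵 Φ Θ) :
    (n : ℝ≥0∞)⁻¹ *
        ∑ m, ∫⁻ j, ENNReal.ofReal (loss (S m) (g w.2.2 (w.1 j))) ∂(π (w.1, w.2.1)) ≤
      2 / (n : ℝ≥0∞) * (∑ m, expectedLoss g q w (S m)) +
        4 * ENNReal.ofReal Δ *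
          (2 / (n : ℝ≥0∞) * (∑ m, InformationTheory.klDiv (q ((w.1, w.2.1), S m))
            (π (w.1, w.2.1)))) ^ (1 / 2 : ℝ) := by
  set kl : Fin n → ℝ≥0∞ := fun m =>
    InformationTheory.klDiv (q ((w.1, w.2.1), S m)) (π (w.1, w.2.1))
  -- The argument gives the sharper constants `1 / n` and `2 * Δ`; the stated ones are slack.
  have hinv : (n : ℝ≥0∞)⁻¹ ≤ 2 / n := by
    rw [← one_div]
    exact ENNReal.div_le_div_right one_le_two _
  have hm : ∀ m, ∫⁻ j, ENNReal.ofReal (loss (S m) (g w.2.2 (w.1 j))) ∂(π (w.1, w.2.1)) ≤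
      expectedLoss g q w (S m) + 2 * ENNReal.ofReal Δ * kl m ^ (1 / 2 : ℝ) := fun m =>
    lintegral_le_add_mul_sqrt_klDiv _ _ (measurable_of_finite _) (by simpa using hΔ)
      fun j => ENNReal.ofReal_le_ofReal (hloss _ _)
  calc (n : ℝ≥0∞)⁻¹ *
        ∑ m, ∫⁻ j, ENNReal.ofReal (loss (S m) (g w.2.2 (w.1 j))) ∂(π (w.1, w.2.1))
      ≤ (n : ℝ≥0∞)⁻¹ *
        ∑ m, (expectedLoss g q w (S m) + 2 * ENNReal.ofReal Δ * kl m ^ (1 / 2 : ℝ)) := by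
        gcongr with m
        exact hm m
    _ = (n : ℝ≥0∞)⁻¹ * (∑ m, expectedLoss g q w (S m)) +
        2 * ENNReal.ofReal Δ * ((n : ℝ≥0∞)⁻¹ * ∑ m, kl m ^ (1 / 2 : ℝ)) := by
        rw [Finset.sum_add_distrib, ← Finset.mul_sum]
        ring
    _ ≤ (n : ℝ≥0∞)⁻¹ * (∑ m, expectedLoss g q w (S m)) +
        2 * ENNReal.ofReal Δ * ((n : ℝ≥0∞)⁻¹ * ∑ m, kl m) ^ (1 / 2 : ℝ) := by
        gcongr
        exact arith_mean_sqrt_le hn kl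
    _ ≤ _ := by
        gcongr
        norm_num

end Bound

end VQVAE

/-! ### Averaging over the sample and the algorithm. -/

theorem theorem5 {d dz dφ dθ : ℕ} (K n : ℕ) (hn : 0 < n)
    (𝒳 : Set (EuclideanSpace ℝ (Fin d))) (𝒵 : Set (EuclideanSpace ℝ (Fin dz)))
    (Φ : Set (EuclideanSpace ℝ (Fin dφ))) (Θ : Set (EuclideanSpace ℝ (Fin dθ)))
    (Δ : ℝ) (hΔ : 0 < Δ) (hbdd : Metric.ediam 𝒳 < ENNReal.ofReal (√Δ))
    (𝒟 : Measure 𝒳) [IsProbabilityMeasure 𝒟]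
    (g : Θ → 𝒵 → 𝒳) (hg : ∀ θ, Measurable (g θ))
    (alg : Kernel (Fin n → 𝒳) (VQVAE.Params K 𝒵 Φ Θ)) [IsMarkovKernel alg]
    (q : Kernel (((Fin K → 𝒵) × Φ) × 𝒳) (Fin K)) [IsMarkovKernel q]
    (π : Kernel ((Fin K → 𝒵) × Φ) (Fin K)) [IsMarkovKernel π] :
    ∫⁻ S, ∫⁻ w, VQVAE.W2 𝒟 (VQVAE.generated g π w) ^ 2 ∂(alg S) ∂(Measure.pi fun _ : Fin n => 𝒟)
      ≤ ENNReal.ofReal (2 * Δ / √(n : ℝ)) +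
        ∫⁻ S, ∫⁻ w,
          (2 / (n : ℝ≥0∞) * (∑ m, VQVAE.expectedLoss g q w (S m)) +
            4 * ENNReal.ofReal Δ *
              (2 / (n : ℝ≥0∞) * (∑ m, InformationTheory.klDiv (q ((w.1, w.2.1), S m))
                (π (w.1, w.2.1)))) ^ (1 / 2 : ℝ))
          ∂(alg S) ∂(Measure.pi fun _ : Fin n => 𝒟) := by
  have hR := VQVAE.norm_sub_le_of_ediam_lt hbdd
  have hloss : ∀ x y : 𝒳, VQVAE.loss x y ≤ Δ := fun x y => by
    simpa [VQVAE.loss, Real.sq_sqrt hΔ.le] using pow_le_pow_left₀ (norm_nonneg _) (hR x y) 2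
  obtain ⟨a, ha⟩ : ∃ a, a = ∫ x : 𝒳, (x : EuclideanSpace ℝ (Fin d)) ∂𝒟 := ⟨_, rfl⟩
  have hY : MemLp (fun x : 𝒳 => (x : EuclideanSpace ℝ (Fin d)) - a) 2 𝒟 :=
    (VQVAE.memLp_subtype_val 𝒟 hR).sub (memLp_const a)
  have hY0 : ∫ x : 𝒳, ((x : EuclideanSpace ℝ (Fin d)) - a) ∂𝒟 = 0 := by
    rw [integral_sub ((VQVAE.memLp_subtype_val 𝒟 hR).integrable (by norm_num))
      (integrable_const a)]
    simp [ha]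
  set P := Measure.pi fun _ : Fin n => 𝒟
  set B : (Fin n → 𝒳) → VQVAE.Params K 𝒵 Φ Θ → ℝ≥0∞ := fun S w =>
    2 / (n : ℝ≥0∞) * (∑ m, VQVAE.expectedLoss g q w (S m)) +
      4 * ENNReal.ofReal Δ *
        (2 / (n : ℝ≥0∞) * (∑ m, InformationTheory.klDiv (q ((w.1, w.2.1), S m))
          (π (w.1, w.2.1)))) ^ (1 / 2 : ℝ)
  set V := ENNReal.ofReal (∫ x : 𝒳, ‖(x : EuclideanSpace ℝ (Fin d)) - a‖ ^ 2 ∂𝒟)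
  set h : (Fin n → 𝒳) → ℝ≥0∞ := fun S =>
    ENNReal.ofReal ((n : ℝ)⁻¹ * ∑ m, ‖(S m : EuclideanSpace ℝ (Fin d)) - a‖ ^ 2)
  set N : (Fin n → 𝒳) → ℝ≥0∞ := fun S =>
    ENNReal.ofReal (2 * √Δ * ‖(n : ℝ)⁻¹ • ∑ m, ((S m : EuclideanSpace ℝ (Fin d)) - a)‖)
  have hh : Measurable h := by fun_prop
  have hN : Measurable N := by fun_prop
  have hpt : ∀ S w, VQVAE.W2 𝒟 (VQVAE.generated g π w) ^ 2 + h S ≤ B S w + (V + N S) :=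
    fun S w => by
      calc VQVAE.W2 𝒟 (VQVAE.generated g π w) ^ 2 + h S
          ≤ _ + h S := by gcongr; exact VQVAE.W2_generated_sq_le 𝒟 g hg π w
        _ ≤ V + _ + N S := VQVAE.lintegral_lintegral_loss_add_le 𝒟 hR hn S
            (π (w.1, w.2.1)) (fun j => g w.2.2 (w.1 j)) ha
        _ ≤ V + B S w + N S := by
            gcongr
            exact VQVAE.mean_lintegral_loss_le g q π hΔ hloss hn S w
        _ = _ := by ring
  have hS : ∀ S, (∫⁻ w, VQVAE.W2 𝒟 (VQVAE.generated g π w) ^ 2 ∂(alg S)) + h S ≤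
      (∫⁻ w, B S w ∂(alg S)) + (V + N S) := fun S => by
    have h1 := lintegral_mono (μ := alg S) (hpt S)
    -- Only the summand split off must be measurable, so none is needed for `W2` or `B` in `w`.
    rw [lintegral_add_right _ measurable_const, lintegral_add_right _ measurable_const] at h1
    simpa using h1
  have hmean : ∫⁻ S, h S ∂P = V := by
    have hsq : Integrable (fun x : 𝒳 => ‖(x : EuclideanSpace ℝ (Fin d)) - a‖ ^ 2) 𝒟 :=
      hY.integrable_norm_pow (by norm_num)
    have hsqS : ∀ m : Fin n, Integrable
        (fun S : Fin n → 𝒳 => ‖(S m : EuclideanSpace ℝ (Fin d)) - a‖ ^ 2) P := fun m =>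
      (measurePreserving_eval (fun _ : Fin n => 𝒟) m).integrable_comp_of_integrable hsq
    have hn' : (n : ℝ) ≠ 0 := Nat.cast_ne_zero.2 hn.ne'
    rw [← ofReal_integral_eq_lintegral_ofReal
      ((integrable_finsetSum _ fun m _ => hsqS m).const_mul _)
      (.of_forall fun S => by positivity), integral_const_mul,
      integral_finsetSum _ fun m _ => hsqS m]
    have heval : ∀ m : Fin n, ∫ S, ‖(S m : EuclideanSpace ℝ (Fin d)) - a‖ ^ 2 ∂P =
        ∫ x : 𝒳, ‖(x : EuclideanSpace ℝ (Fin d)) - a‖ ^ 2 ∂𝒟 := fun m =>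
      integral_comp_eval (μ := fun _ : Fin n => 𝒟)
        (f := fun x : 𝒳 => ‖(x : EuclideanSpace ℝ (Fin d)) - a‖ ^ 2) hsq.aestronglyMeasurable
    simp [heval, hn', V]
  have hNle : ∫⁻ S, N S ∂P ≤ ENNReal.ofReal (2 * Δ / √(n : ℝ)) := by
    have h1 := VQVAE.lintegral_norm_empirical_mean_le 𝒟 hY hY0 hn (Real.sqrt_nonneg Δ)
      fun x => ha ▸ VQVAE.norm_sub_integral_le 𝒟 hR x
    simp only [N, ENNReal.ofReal_mul (show 0 ≤ 2 * √Δ by positivity)]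
    rw [lintegral_const_mul _ (by fun_prop)]
    -- One `√Δ` bounds decoded points about `a`, the other the data about `a`.
    calc _ ≤ ENNReal.ofReal (2 * √Δ) * ENNReal.ofReal (√Δ / √n) := by gcongr
      _ = _ := by
        rw [← ENNReal.ofReal_mul (by positivity)]
        congr 1
        rw [mul_div_assoc', mul_assoc, Real.mul_self_sqrt hΔ.le]
  have hint := lintegral_mono (μ := P) hS
  rw [lintegral_add_right _ hh, lintegral_add_right (g := fun S => V + N S) _ (by fun_prop),
    lintegral_add_left measurable_const, hmean] at hint
  simp only [lintegral_const, measure_univ, mul_one] at hint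
  have hV : V ≠ ∞ := ENNReal.ofReal_ne_top
  refine (ENNReal.add_le_add_iff_right hV).1 (hint.trans ?_)
  calc _ ≤ (∫⁻ S, ∫⁻ w, B S w ∂(alg S) ∂P) + (V + ENNReal.ofReal (2 * Δ / √(n : ℝ))) := by
        gcongr
    _ = _ := by ring
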